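/- Let $N\ge 1$, let $\Omega\subset\mathbb R^N$ be a bounded open set, and let $0<\lambda<\Lambda$ and $\varepsilon>0$. Let $f:\Omega\to\mathbb R$ be uniformly continuous and bounded, and let $g:\mathbb R^N\setminus\Omega\to\mathbb R$ be continuous and bounded. Consider the following one-player game. A token is placed at $x_0\in\mathbb R^N$. A move is an orthonormal basis $v_1,\dots,v_N$ of $\mathbb R^N$ together with numbers $\mu_1,\dots,\mu_N\in\{\sqrt\lambda,\sqrt\Lambda\}$. A strategy $S$ is a Borel function which assigns a move to every partial history $(x_0,\dots,x_n)$, $n\ge 0$. As long as $x_n\in\Omega$, the next position $x_{n+1}$ is one of the $2N$ points $x_n\pm\varepsilon\mu_iv_i$, each chosen with probability $\frac1{2N}$, where $(v_1,\dots,v_N,\mu_1,\dots,\mu_N)=S(x_0,\dots,x_n)$. The game stops at the first time $\tau\ge 0$ with $x_\tau\notin\Omega$ (so $\tau=0$ if $x_0\notin\Omega$). Let $\mathbb E^{x_0}_S$ denote the expectation for the resulting probability measure on game sequences, and define the value of the game, for $x_0\in\mathbb R^N$, by $$u^\varepsilon(x_0)=\sup_S\ \mathbb E^{x_0}_S\Big[g(x_\tau)-\frac{1}{2N}\varepsilon^2\sum_{k=0}^{\tau-1}f(x_k)\Big].$$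 Then, for every strategy and every starting point, $\tau<\infty$ almost surely and the payoff is integrable; the supremum defining $u^\varepsilon$ and the supremum below are finite; and $u^\varepsilon$ satisfies the Dynamic Programming Principle $$u^\varepsilon(x)=-\frac{1}{2N}\varepsilon^2f(x)+\frac1{2N}\sup_{v_i,\mu_i}\sum_{i=1}^N\big[u^\varepsilon(x+\varepsilon\mu_iv_i)+u^\varepsilon(x-\varepsilon\mu_iv_i)\big]\qquad\text{for } x\in\Omega,$$ $$u^\varepsilon(x)=g(x)\qquad\text{for } x\notin\Omega,$$ where the supremum is over all moves, that is, over all orthonormal bases $v_1,\dots,v_N$ of $\mathbb R^N$ and all $\mu_1,\dots,\mu_N\in\{\sqrt\lambda,\sqrt\Lambda\}$. -/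

import Mathlib

open MeasureTheory ProbabilityTheory
open scoped ENNReal

noncomputable section

namespace PucciGame

/-- A move of the player: an orthonormal basis `v` of `ℝᴺ` together with numbers
`μ i ∈ {√lam, √Lam}`. -/
structure Move (N : ℕ) (lam Lam : ℝ) where
  v : OrthonormalBasis (Fin N) ℝ (EuclideanSpace ℝ (Fin N))
  μ : Fin N → ℝ
  μ_mem : ∀ i, μ i = Real.sqrt lam ∨ μ i = Real.sqrt Lam

/-- The partial histories `(x₀, …, xₙ)`. -/
abbrev History (N n : ℕ) : Type := (_ : Finset.Iic n) → EuclideanSpace ℝ (Fin N)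

/-- The game sequences `(x₀, x₁, …)`. -/
abbrev Path (N : ℕ) : Type := (_ : ℕ) → EuclideanSpace ℝ (Fin N)

/-- The current position `xₙ` of a history `(x₀, …, xₙ)`. -/
def History.last {N n : ℕ} (h : History N n) : EuclideanSpace ℝ (Fin N) :=
  h ⟨n, Finset.mem_Iic.2 le_rfl⟩

/-- A strategy: a Borel function that assigns a move to every partial history. -/
structure Strategy (N : ℕ) (lam Lam : ℝ) where
  act : (n : ℕ) → History N n → Move N lam Lam
  measurable_v : ∀ n, Measurable fun (h : History N n) (i : Fin N) => (act n h).v i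
  measurable_μ : ∀ n, Measurable fun h : History N n => (act n h).μ

variable {N : ℕ} {lam Lam : ℝ}

/-- The law of the next position from `x` when the move `m` is played: the points
`x ± ε μᵢ vᵢ` have probability `1/(2N)` each. -/
def Move.law (m : Move N lam Lam) (ε : ℝ) (x : EuclideanSpace ℝ (Fin N)) :
    Measure (EuclideanSpace ℝ (Fin N)) :=
  (2 * (N : ℝ≥0∞))⁻¹ •
    ∑ i, (Measure.dirac (x + (ε * m.μ i) • m.v i) + Measure.dirac (x - (ε * m.μ i) • m.v i))

open Classical in
/-- The law of the next position after the history `h`. As long as the token is in `Ω` it moves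
according to the strategy; once it has left `Ω` the game is over and the token rests. -/
def Strategy.stepLaw (S : Strategy N lam Lam) (Ω : Set (EuclideanSpace ℝ (Fin N))) (ε : ℝ)
    {n : ℕ} (h : History N n) : Measure (EuclideanSpace ℝ (Fin N)) :=
  if h.last ∈ Ω then (S.act n h).law ε h.last else Measure.dirac h.last

lemma History.measurable_last {n : ℕ} : Measurable (History.last : History N n → _) :=
  measurable_pi_apply _

lemma Strategy.measurable_stepLaw (S : Strategy N lam Lam) {Ω : Set (EuclideanSpace ℝ (Fin N))}
    (hΩ : IsOpen Ω) (ε : ℝ) (n : ℕ) : Measurable fun h : History N n => S.stepLaw Ω ε h := by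
  have hl : Measurable (History.last : History N n → _) := History.measurable_last
  refine Measurable.ite (hl hΩ.measurableSet) ?_ (Measure.measurable_dirac.comp hl)
  refine Measure.measurable_of_measurable_coe _ fun s hs => ?_
  have hd : ∀ i : Fin N, Measurable fun h : History N n =>
      (ε * (S.act n h).μ i) • (S.act n h).v i := fun i =>
    (((measurable_pi_apply i).comp (S.measurable_μ n)).const_mul ε).smul
      ((measurable_pi_apply i).comp (S.measurable_v n))
  simp only [Move.law, Measure.smul_apply, Measure.finsetSum_apply, Measure.add_apply,
    smul_eq_mul]
  refine Measurable.const_mul (Finset.measurable_fun_sum _ fun i _ => ?_) _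
  exact ((Measure.measurable_coe hs).comp (Measure.measurable_dirac.comp (hl.add (hd i)))).add
    ((Measure.measurable_coe hs).comp (Measure.measurable_dirac.comp (hl.sub (hd i))))

instance Move.isProbabilityMeasure_law [NeZero N] (m : Move N lam Lam) (ε : ℝ)
    (x : EuclideanSpace ℝ (Fin N)) : IsProbabilityMeasure (m.law ε x) := by
  constructor
  have h0 : (N : ℝ≥0∞) ≠ 0 := by exact_mod_cast NeZero.ne N
  simp only [Move.law, Measure.smul_apply, Measure.finsetSum_apply, Measure.add_apply,
    smul_eq_mul, measure_univ, Finset.sum_const, Finset.card_univ, Fintype.card_fin, nsmul_eq_mul]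
  rw [one_add_one_eq_two, mul_comm (N : ℝ≥0∞) 2]
  exact ENNReal.inv_mul_cancel (by simp [h0])
    (ENNReal.mul_ne_top (by simp) (ENNReal.natCast_ne_top N))

/-- The one step transition probabilities of the game, as Markov kernels. -/
def Strategy.kernel (S : Strategy N lam Lam) {Ω : Set (EuclideanSpace ℝ (Fin N))}
    (hΩ : IsOpen Ω) (ε : ℝ) (n : ℕ) : Kernel (History N n) (EuclideanSpace ℝ (Fin N)) where
  toFun h := S.stepLaw Ω ε h
  measurable' := S.measurable_stepLaw hΩ ε n

instance Strategy.isMarkovKernel_kernel [NeZero N] (S : Strategy N lam Lam)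
    {Ω : Set (EuclideanSpace ℝ (Fin N))} (hΩ : IsOpen Ω) (ε : ℝ) (n : ℕ) :
    IsMarkovKernel (S.kernel hΩ ε n) := by
  refine ⟨fun h => ?_⟩
  change IsProbabilityMeasure (S.stepLaw Ω ε h)
  unfold Strategy.stepLaw
  split_ifs <;> infer_instance

/-- The probability measure on game sequences determined by the starting point `x₀` and the
strategy `S`. -/
def Strategy.pathLaw [NeZero N] (S : Strategy N lam Lam) {Ω : Set (EuclideanSpace ℝ (Fin N))}
    (hΩ : IsOpen Ω) (ε : ℝ) (x₀ : EuclideanSpace ℝ (Fin N)) : Measure (Path N) :=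
  Kernel.traj (X := fun _ => EuclideanSpace ℝ (Fin N)) (fun n => S.kernel hΩ ε n) 0 (fun _ => x₀)

/-- The exit time `τ`, the first `k` with `xₖ ∉ Ω` (for sequences that leave `Ω`). -/
def exitTime (Ω : Set (EuclideanSpace ℝ (Fin N))) (ω : Path N) : ℕ :=
  sInf {k | ω k ∉ Ω}

/-- The total payoff `g(x_τ) - (ε²/2N) ∑_{k<τ} f(xₖ)`. -/
def payoff (Ω : Set (EuclideanSpace ℝ (Fin N))) (ε : ℝ) (f g : EuclideanSpace ℝ (Fin N) → ℝ)
    (ω : Path N) : ℝ :=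
  g (ω (exitTime Ω ω)) -
    1 / (2 * (N : ℝ)) * ε ^ 2 * ∑ k ∈ Finset.range (exitTime Ω ω), f (ω k)

/-- The expected payoff of the strategy `S` when the game starts at `x₀`. -/
def Strategy.expectedPayoff [NeZero N] (S : Strategy N lam Lam)
    {Ω : Set (EuclideanSpace ℝ (Fin N))} (hΩ : IsOpen Ω) (ε : ℝ)
    (f g : EuclideanSpace ℝ (Fin N) → ℝ) (x₀ : EuclideanSpace ℝ (Fin N)) : ℝ :=
  ∫ ω, payoff Ω ε f g ω ∂(S.pathLaw hΩ ε x₀)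

/-- The value of the game: the supremum of the expected payoff over all strategies. -/
def value [NeZero N] {Ω : Set (EuclideanSpace ℝ (Fin N))} (hΩ : IsOpen Ω) (lam Lam ε : ℝ)
    (f g : EuclideanSpace ℝ (Fin N) → ℝ) (x₀ : EuclideanSpace ℝ (Fin N)) : ℝ :=
  ⨆ S : Strategy N lam Lam, S.expectedPayoff hΩ ε f g x₀

/-- `∑ᵢ [u(x + ε μᵢ vᵢ) + u(x - ε μᵢ vᵢ)]`. -/
def Move.total (m : Move N lam Lam) (ε : ℝ) (u : EuclideanSpace ℝ (Fin N) → ℝ)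
    (x : EuclideanSpace ℝ (Fin N)) : ℝ :=
  ∑ i, (u (x + (ε * m.μ i) • m.v i) + u (x - (ε * m.μ i) • m.v i))

end PucciGame

end

/-!
Every randomization in the game has only `2N` outcomes, so the dynamic programming principle can be
proved without any measurable selection and without knowing that the value function is measurable.

The key fact is a Markov property at time one (`Strategy.map_shift_pathLawFrom`): given that the
first two positions are `x` and `y`, the shifted sequence `(x₁, x₂, …)` is distributed as a fresh
game from `y`, played with any strategy `T` that continues the given strategy `S` after `x, y`. It
holds because both laws have the same one step transition probabilities, and these determine the
law (`eq_traj_of_transitions`). Splitting off the first round of the payoff, one gets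
`Strategy.expectedPayoff_eq_total`: the expected payoff of `S` from `x ∈ Ω` is the first running
cost plus the average, over the `2N` possible positions `y`, of the expected payoffs from `y`.

* Bounding the latter by the value at `y` gives `≤` in the principle.
* For `≥`, fix a move `m` and choose a `δ`-optimal strategy for each of the `2N` positions that `m`
  can lead to. Playing `m` first and then the strategy that belongs to the position reached is again
  a Borel strategy, as only finitely many strategies are pasted (`Strategy.prepend`).

That the game ends, and that all expectations are bounded uniformly in the strategy and the starting
point, follows from the potential `(R² - |x|²)⁺`: as `Ω` is bounded, `R` can be chosen so large that
by the parallelogram law each round lowers its expectation by at least `ε² lam`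
(`Move.lintegral_potential_add_le`). Hence the expected number of rounds is at most `R² / (ε² lam)`
(`exists_lintegral_occupation_le`).
-/

namespace PucciGame

variable {N : ℕ} {lam Lam : ℝ}

/-! ### Laws of sequences are determined by their one step transitions -/

lemma measure_ext_frestrictLe {E : Type*} [MeasurableSpace E] {μ ν : Measure (ℕ → E)}
    [IsFiniteMeasure μ] [IsFiniteMeasure ν]
    (h : ∀ n, μ.map (Preorder.frestrictLe n) = ν.map (Preorder.frestrictLe n)) : μ = ν := by
  have hν : IsProjectiveLimit ν (fun I : Finset ℕ => ν.map I.restrict) := fun I => rfl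
  refine IsProjectiveLimit.unique (P := fun I : Finset ℕ => ν.map I.restrict) (fun I => ?_) hν
  have hI : I ⊆ Finset.Iic (I.sup id) := I.subset_Iic_sup_id
  have hr : (I.restrict : (ℕ → E) → _) =
      Finset.restrict₂ hI ∘ Preorder.frestrictLe (I.sup id) := rfl
  have hm : Measurable (Finset.restrict₂ (π := fun _ : ℕ => E) hI) :=
    Finset.measurable_restrict₂ (X := fun _ : ℕ => E) hI
  change μ.map I.restrict = ν.map I.restrict
  rw [hr, ← Measure.map_map hm (by fun_prop), h, Measure.map_map hm (by fun_prop)]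

/-- A law of sequences that starts at `x₀` and has transition probabilities `κ` is the
Ionescu-Tulcea measure. -/
lemma eq_traj_of_transitions {E : Type*} [MeasurableSpace E]
    (κ : (n : ℕ) → Kernel ((_ : Finset.Iic n) → E) E) [∀ n, IsMarkovKernel (κ n)]
    (μ : Measure (ℕ → E)) [IsProbabilityMeasure μ] (x₀ : (_ : Finset.Iic 0) → E)
    (h0 : μ.map (Preorder.frestrictLe 0) = Measure.dirac x₀)
    (hs : ∀ n, μ.map (fun ω => (Preorder.frestrictLe n ω, ω (n + 1))) =
      (μ.map (Preorder.frestrictLe n)) ⊗ₘ κ n) :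
    μ = Kernel.traj (X := fun _ => E) κ 0 x₀ := by
  refine measure_ext_frestrictLe fun n => ?_
  induction n with
  | zero =>
    rw [h0, Kernel.traj_map_frestrictLe_apply, Kernel.partialTraj_self, Kernel.id_apply]
  | succ n ih =>
    let glue : ((_ : Finset.Iic n) → E) × E → (_ : Finset.Iic (n + 1)) → E :=
      fun p i => if hi : i.1 ≤ n then p.1 ⟨i.1, Finset.mem_Iic.2 hi⟩ else p.2
    have hglue : Measurable glue := by
      refine measurable_pi_lambda _ fun i => ?_
      by_cases hi : i.1 ≤ n
      · simp only [glue, hi, dite_true]; fun_prop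
      · simp only [glue, hi, dite_false]; fun_prop
    have hcomp : (Preorder.frestrictLe (n + 1) : (ℕ → E) → _) =
        glue ∘ fun ω => (Preorder.frestrictLe n ω, ω (n + 1)) := by
      funext ω i
      by_cases hi : i.1 ≤ n
      · simp [glue, hi]
      · have : i.1 = n + 1 := le_antisymm (Finset.mem_Iic.1 i.2) (by omega)
        simp [glue, this]
    rw [hcomp, ← Measure.map_map hglue (by fun_prop), ← Measure.map_map hglue (by fun_prop), hs, ih,
      Kernel.traj_map_frestrictLe_apply,
      Kernel.partialTraj_compProd_eq_map_traj (X := fun _ => E) (Nat.zero_le n)]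

lemma ae_frestrictLe_traj {E : Type*} [MeasurableSpace E] [MeasurableSingletonClass E]
    (κ : (n : ℕ) → Kernel ((_ : Finset.Iic n) → E) E) [∀ n, IsMarkovKernel (κ n)]
    (a : ℕ) (p : (_ : Finset.Iic a) → E) :
    ∀ᵐ ω ∂(Kernel.traj (X := fun _ => E) κ a p), Preorder.frestrictLe a ω = p := by
  have h := Kernel.traj_map_frestrictLe_apply (X := fun _ => E) (κ := κ) a a p
  rw [Kernel.partialTraj_self, Kernel.id_apply] at h
  refine ae_of_ae_map (f := (Preorder.frestrictLe a : (ℕ → E) → (_ : Finset.Iic a) → E))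
    (p := fun q => q = p) (by fun_prop) ?_
  rw [h, ae_dirac_eq]
  exact rfl

/-! ### Histories and strategies after the first move -/

/-- The history `(x₁, …, xₙ₊₁)` obtained from `(x₀, …, xₙ₊₁)` by forgetting the starting point. -/
def History.tail {n : ℕ} (h : History N (n + 1)) : History N n :=
  fun i => h ⟨i.1 + 1, Finset.mem_Iic.2 (Nat.succ_le_succ (Finset.mem_Iic.1 i.2))⟩

/-- The history `(x, x₀, …, xₙ)`. -/
def History.cons {n : ℕ} (x : EuclideanSpace ℝ (Fin N)) (h : History N n) : History N (n + 1) :=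
  fun i => if i.1 = 0 then x else
    h ⟨i.1 - 1, Finset.mem_Iic.2 (Nat.sub_le_of_le_add (Finset.mem_Iic.1 i.2))⟩

/-- The history `(x, y)`. -/
def History.pair (x y : EuclideanSpace ℝ (Fin N)) : History N 1 :=
  History.cons (n := 0) x fun _ => y

/-- The `k`-th position of a history. -/
def History.pos {n : ℕ} (h : History N n) (k : ℕ) (hk : k ≤ n) : EuclideanSpace ℝ (Fin N) :=
  h ⟨k, Finset.mem_Iic.2 hk⟩

/-- The sequence `(x₁, x₂, …)`. -/
def Path.shift (ω : Path N) : Path N := fun n => ω (n + 1)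

lemma History.measurable_tail {n : ℕ} : Measurable (History.tail : History N (n + 1) → _) :=
  measurable_pi_lambda _ fun _ => measurable_pi_apply _

lemma History.measurable_cons {n : ℕ} (x : EuclideanSpace ℝ (Fin N)) :
    Measurable (History.cons x : History N n → _) := by
  refine measurable_pi_lambda _ fun i => ?_
  unfold History.cons
  split_ifs
  · exact measurable_const
  · exact measurable_pi_apply _

lemma Path.measurable_shift : Measurable (Path.shift : Path N → Path N) :=
  measurable_pi_lambda _ fun _ => measurable_pi_apply _

lemma History.cons_tail {n : ℕ} (h : History N (n + 1)) {x : EuclideanSpace ℝ (Fin N)}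
    (hx : h.pos 0 (Nat.zero_le _) = x) : h.tail.cons x = h := by
  funext ⟨i, hi⟩
  cases i with
  | zero => simp [History.cons, ← hx, History.pos]
  | succ i => simp [History.cons, History.tail]

/-- The strategy that plays like `S` does after the game has started in `x`. -/
def Strategy.after (S : Strategy N lam Lam) (x : EuclideanSpace ℝ (Fin N)) :
    Strategy N lam Lam where
  act n h := S.act (n + 1) (h.cons x)
  measurable_v n := (S.measurable_v (n + 1)).comp (History.measurable_cons x)
  measurable_μ n := (S.measurable_μ (n + 1)).comp (History.measurable_cons x)

/-- Selecting a measurable function by a measurable index of countable range is measurable,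
without any joint measurability. -/
lemma measurable_select {α β E : Type*} [MeasurableSpace α] [MeasurableSpace β] [MeasurableSpace E]
    [MeasurableSingletonClass E] {G : E → α → β} (hG : ∀ y, Measurable (G y)) {k : α → E}
    (hk : Measurable k) (hkc : (Set.range k).Countable) : Measurable fun a => G (k a) a := by
  intro s hs
  have : (fun a => G (k a) a) ⁻¹' s = ⋃ y ∈ Set.range k, k ⁻¹' {y} ∩ G y ⁻¹' s := by
    ext a
    simp only [Set.mem_preimage, Set.mem_iUnion, Set.mem_inter_iff, Set.mem_singleton_iff,
      exists_prop]
    exact ⟨fun h => ⟨k a, ⟨a, rfl⟩, rfl, h⟩, fun ⟨y, _, hy, h⟩ => hy ▸ h⟩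
  rw [this]
  exact MeasurableSet.biUnion hkc fun y _ => (hk (measurableSet_singleton y)).inter (hG y hs)

/-- The strategy that plays `m` first and then, from the position `y`, follows the strategy
`σ (k y)`. The map `k` has countable range, which makes this choice measurable for arbitrary `σ`. -/
def Strategy.prepend (m : Move N lam Lam) (σ : EuclideanSpace ℝ (Fin N) → Strategy N lam Lam)
    (k : EuclideanSpace ℝ (Fin N) → EuclideanSpace ℝ (Fin N)) (hk : Measurable k)
    (hkc : (Set.range k).Countable) : Strategy N lam Lam where
  act n := match n with
    | 0 => fun _ => m
    | n + 1 => fun h => (σ (k (h.pos 1 (by omega)))).act n h.tail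
  measurable_v n := match n with
    | 0 => measurable_const (a := fun i => m.v i)
    | n + 1 => measurable_select (G := fun y (h : History N (n + 1)) i => ((σ y).act n h.tail).v i)
        (fun y => ((σ y).measurable_v n).comp History.measurable_tail)
        (hk.comp (measurable_pi_apply _))
        (hkc.mono (Set.range_comp_subset_range _ k))
  measurable_μ n := match n with
    | 0 => measurable_const (a := m.μ)
    | n + 1 => measurable_select (G := fun y (h : History N (n + 1)) => ((σ y).act n h.tail).μ)
        (fun y => ((σ y).measurable_μ n).comp History.measurable_tail)
        (hk.comp (measurable_pi_apply _))
        (hkc.mono (Set.range_comp_subset_range _ k))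

/-- `T` continues `S` after the positions `x, y`: once the game has gone from `x` to `y`, the
strategy `S` plays as `T` does in a game that starts in `y`. -/
def Strategy.Continues (S T : Strategy N lam Lam) (x y : EuclideanSpace ℝ (Fin N)) : Prop :=
  ∀ (n : ℕ) (h : History N (n + 1)), h.pos 0 (by omega) = x → h.pos 1 (by omega) = y →
    T.act n h.tail = S.act (n + 1) h

lemma Strategy.continues_after (S : Strategy N lam Lam) (x y : EuclideanSpace ℝ (Fin N)) :
    S.Continues (S.after x) x y := fun n h hx _ => by
  change S.act (n + 1) (h.tail.cons x) = _
  rw [h.cons_tail hx]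

lemma Strategy.continues_prepend (m : Move N lam Lam)
    (σ : EuclideanSpace ℝ (Fin N) → Strategy N lam Lam)
    (k : EuclideanSpace ℝ (Fin N) → EuclideanSpace ℝ (Fin N)) (hk : Measurable k)
    (hkc : (Set.range k).Countable) (x y : EuclideanSpace ℝ (Fin N)) (hy : k y = y) :
    (Strategy.prepend m σ k hk hkc).Continues (σ y) x y := fun n h _ h1 => by
  change (σ y).act n h.tail = (σ (k (h.pos 1 (Nat.le_add_left 1 n)))).act n h.tail
  rw [h1, hy]

/-! ### The Markov property at time one -/

section Markov

variable [NeZero N] {Ω : Set (EuclideanSpace ℝ (Fin N))}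

/-- The law of the game sequence given the first two positions `x, y`. -/
noncomputable def Strategy.pathLawFrom (S : Strategy N lam Lam) (hΩ : IsOpen Ω) (ε : ℝ)
    (x y : EuclideanSpace ℝ (Fin N)) : Measure (Path N) :=
  Kernel.traj (X := fun _ => EuclideanSpace ℝ (Fin N)) (fun n => S.kernel hΩ ε n) 1
    (History.pair x y)

instance (S : Strategy N lam Lam) (hΩ : IsOpen Ω) (ε : ℝ) (x : EuclideanSpace ℝ (Fin N)) :
    IsProbabilityMeasure (S.pathLaw hΩ ε x) := by
  unfold Strategy.pathLaw; infer_instance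

instance (S : Strategy N lam Lam) (hΩ : IsOpen Ω) (ε : ℝ) (x y : EuclideanSpace ℝ (Fin N)) :
    IsProbabilityMeasure (S.pathLawFrom hΩ ε x y) := by
  unfold Strategy.pathLawFrom; infer_instance

lemma Strategy.ae_pathLaw_zero (S : Strategy N lam Lam) (hΩ : IsOpen Ω) (ε : ℝ)
    (x : EuclideanSpace ℝ (Fin N)) : ∀ᵐ ω ∂(S.pathLaw hΩ ε x), ω 0 = x := by
  filter_upwards [ae_frestrictLe_traj (fun n => S.kernel hΩ ε n) 0 (fun _ => x)] with ω hω
  exact congrFun hω ⟨0, by simp⟩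

lemma Strategy.ae_pathLawFrom (S : Strategy N lam Lam) (hΩ : IsOpen Ω) (ε : ℝ)
    (x y : EuclideanSpace ℝ (Fin N)) :
    ∀ᵐ ω ∂(S.pathLawFrom hΩ ε x y), ω 0 = x ∧ ω 1 = y := by
  filter_upwards [ae_frestrictLe_traj (fun n => S.kernel hΩ ε n) 1
    (History.pair x y)] with ω hω
  exact ⟨congrFun hω ⟨0, by simp⟩, congrFun hω ⟨1, by simp⟩⟩

/-- After the first step, the game goes on as a fresh game from the new position, played with any
strategy that continues `S`. -/
lemma Strategy.map_shift_pathLawFrom {S T : Strategy N lam Lam} {x y : EuclideanSpace ℝ (Fin N)}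
    (hST : S.Continues T x y) (hΩ : IsOpen Ω) (ε : ℝ) :
    (S.pathLawFrom hΩ ε x y).map Path.shift = T.pathLaw hΩ ε y := by
  set μ := S.pathLawFrom hΩ ε x y with hμ
  have : IsProbabilityMeasure (μ.map Path.shift) :=
    Measure.isProbabilityMeasure_map Path.measurable_shift.aemeasurable
  refine eq_traj_of_transitions _ _ _ ?_ fun n => ?_
  · rw [Measure.map_map (by fun_prop) Path.measurable_shift]
    have : (Preorder.frestrictLe 0 ∘ Path.shift : Path N → History N 0) =ᵐ[μ] fun _ _ => y := by
      filter_upwards [S.ae_pathLawFrom hΩ ε x y] with ω hω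
      funext ⟨i, hi⟩
      obtain rfl : i = 0 := by simpa using hi
      exact hω.2
    rw [Measure.map_congr this, Measure.map_const, measure_univ, one_smul]
  · have h1 : (fun ω : Path N => ((Preorder.frestrictLe n ω : History N n), ω (n + 1))) ∘
        Path.shift = Prod.map History.tail id ∘
          fun ω => (Preorder.frestrictLe (n + 1) ω, ω (n + 1 + 1)) := rfl
    have h2 : (Preorder.frestrictLe n ∘ Path.shift : Path N → History N n) =
        History.tail ∘ Preorder.frestrictLe (n + 1) := rfl
    have hjoint : μ.map (fun ω => ((Preorder.frestrictLe (n + 1) ω : History N (n + 1)),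
        ω (n + 1 + 1))) = (μ.map (Preorder.frestrictLe (n + 1))) ⊗ₘ S.kernel hΩ ε (n + 1) := by
      rw [hμ, Strategy.pathLawFrom, Kernel.traj_map_frestrictLe_apply,
        Kernel.partialTraj_compProd_eq_map_traj (X := fun _ => EuclideanSpace ℝ (Fin N))
          (κ := fun n => S.kernel hΩ ε n) (b := n + 1) (by omega)]
    have htail : Measurable (History.tail : History N (n + 1) → _) := History.measurable_tail
    rw [Measure.map_map (by fun_prop) Path.measurable_shift,
      Measure.map_map (by fun_prop) Path.measurable_shift, h1, h2,
      ← Measure.map_map (htail.prodMap measurable_id) (by fun_prop), hjoint,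
      ← Measure.map_map htail (by fun_prop)]
    have hρ : ∀ᵐ h : History N (n + 1) ∂(μ.map (Preorder.frestrictLe (n + 1) : Path N → History N (n + 1))),
        S.kernel hΩ ε (n + 1) h = T.kernel hΩ ε n h.tail := by
      have hpos : ∀ᵐ h : History N (n + 1) ∂(μ.map (Preorder.frestrictLe (n + 1) : Path N → History N (n + 1))),
          h.pos 0 (by omega) = x ∧ h.pos 1 (by omega) = y := by
        rw [ae_map_iff (by fun_prop)]
        · exact S.ae_pathLawFrom hΩ ε x y
        · exact (measurableSet_eq_fun (measurable_pi_apply _) measurable_const).inter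
            (measurableSet_eq_fun (measurable_pi_apply _) measurable_const)
      filter_upwards [hpos] with h hh
      change S.stepLaw Ω ε h = T.stepLaw Ω ε h.tail
      have hl : h.tail.last = h.last := rfl
      rw [Strategy.stepLaw, Strategy.stepLaw, hl, hST n h hh.1 hh.2]
    ext s hs
    rw [Measure.map_apply (htail.prodMap measurable_id) hs,
      Measure.compProd_apply (htail.prodMap measurable_id hs), Measure.compProd_apply hs,
      lintegral_map (Kernel.measurable_kernel_prodMk_left hs) htail]
    refine lintegral_congr_ae ?_
    filter_upwards [hρ] with h hh
    rw [hh]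
    rfl

/-- The law of the game is the average, over the `2N` possible outcomes of the first step, of the
laws given that outcome. -/
lemma Strategy.pathLaw_eq_average (S : Strategy N lam Lam) (hΩ : IsOpen Ω) (ε : ℝ)
    {x : EuclideanSpace ℝ (Fin N)} (hx : x ∈ Ω) :
    let m := S.act 0 fun _ => x
    S.pathLaw hΩ ε x = (2 * (N : ℝ≥0∞))⁻¹ • ∑ i,
      (S.pathLawFrom hΩ ε x (x + (ε * m.μ i) • m.v i) +
        S.pathLawFrom hΩ ε x (x - (ε * m.μ i) • m.v i)) := by
  intro m
  have hmeas : Measurable fun y => History.pair x y := by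
    refine measurable_pi_lambda _ fun i => ?_
    unfold History.pair History.cons
    split_ifs <;> fun_prop
  have hpart : Kernel.partialTraj (X := fun _ => EuclideanSpace ℝ (Fin N))
      (fun n => S.kernel hΩ ε n) 0 1 (fun _ => x) =
      (m.law ε x).map fun y => History.pair x y := by
    have hk : S.kernel hΩ ε 0 (fun _ => x) = m.law ε x := if_pos hx
    have hc := Kernel.map_traj_succ_self (X := fun _ => EuclideanSpace ℝ (Fin N))
      (κ := fun n => S.kernel hΩ ε n) (a := 0)
    have hc' := congrArg (fun η => η (fun _ => x)) hc
    simp only [Kernel.map_apply _ (measurable_pi_apply (0 + 1)), hk] at hc'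
    rw [← hc', Measure.map_map hmeas (by fun_prop), ← Kernel.traj_map_frestrictLe_apply]
    refine Measure.map_congr ?_
    filter_upwards [S.ae_pathLaw_zero hΩ ε x] with ω hω
    funext ⟨i, hi⟩
    have : i = 0 ∨ i = 1 := by have := Finset.mem_Iic.1 hi; omega
    rcases this with rfl | rfl
    · simpa [History.pair, History.cons] using hω
    · simp [History.pair, History.cons]
  ext s hs
  rw [Strategy.pathLaw, ← Kernel.traj_comp_partialTraj (X := fun _ => EuclideanSpace ℝ (Fin N))
    (κ := fun n => S.kernel hΩ ε n) (Nat.zero_le 1), Kernel.comp_apply' _ _ _ hs, hpart,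
    lintegral_map (Kernel.measurable_coe _ hs) hmeas, Move.law, lintegral_smul_measure,
    lintegral_finsetSum_measure]
  simp only [lintegral_add_measure, Measure.smul_apply, Measure.finsetSum_apply,
    Measure.add_apply, smul_eq_mul, Strategy.pathLawFrom]
  congr 1
  refine Finset.sum_congr rfl fun i _ => ?_
  rw [lintegral_dirac, lintegral_dirac]

end Markov

variable {Ω : Set (EuclideanSpace ℝ (Fin N))}

/-! ### The number of rounds has uniformly bounded expectation -/

lemma Move.lintegral_law (m : Move N lam Lam) (ε : ℝ) (x : EuclideanSpace ℝ (Fin N))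
    (F : EuclideanSpace ℝ (Fin N) → ℝ≥0∞) :
    ∫⁻ y, F y ∂(m.law ε x) = (2 * (N : ℝ≥0∞))⁻¹ *
      ∑ i, (F (x + (ε * m.μ i) • m.v i) + F (x - (ε * m.μ i) • m.v i)) := by
  rw [Move.law, lintegral_smul_measure, lintegral_finsetSum_measure]
  simp only [lintegral_add_measure, lintegral_dirac, smul_eq_mul]

/-- The potential `(R² - |x|²)⁺`, which decreases by at least `ε² lam` on average in each step. -/
noncomputable def potential (R : ℝ) (x : EuclideanSpace ℝ (Fin N)) : ℝ≥0∞ :=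
  ENNReal.ofReal (R ^ 2 - ‖x‖ ^ 2)

lemma measurable_potential (R : ℝ) : Measurable (potential (N := N) R) := by
  unfold potential; fun_prop

lemma Move.bounds (hlam : 0 < lam) (hLam : lam < Lam) (m : Move N lam Lam) (i : Fin N) :
    0 ≤ m.μ i ∧ lam ≤ m.μ i ^ 2 ∧ m.μ i ≤ Real.sqrt Lam := by
  rcases m.μ_mem i with h | h <;> rw [h]
  · exact ⟨Real.sqrt_nonneg _, (Real.sq_sqrt hlam.le).ge, Real.sqrt_le_sqrt hLam.le⟩
  · exact ⟨Real.sqrt_nonneg _, by rw [Real.sq_sqrt (hlam.trans hLam).le]; exact hLam.le, le_rfl⟩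

/-- The drift inequality, from the parallelogram law `|x + w|² + |x - w|² = 2|x|² + 2|w|²`. -/
lemma Move.lintegral_potential_add_le [NeZero N] (hlam : 0 < lam) (hLam : lam < Lam)
    {ε r : ℝ} (hε : 0 < ε)
    (m : Move N lam Lam) {x : EuclideanSpace ℝ (Fin N)} (hx : ‖x‖ ≤ r) :
    ∫⁻ y, potential (r + ε * Real.sqrt Lam) y ∂(m.law ε x) + ENNReal.ofReal (ε ^ 2 * lam) ≤
      potential (r + ε * Real.sqrt Lam) x := by
  set R := r + ε * Real.sqrt Lam
  have hN : (0 : ℝ) < 2 * N := by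
    have : (0 : ℝ) < N := by exact_mod_cast Nat.pos_of_ne_zero (NeZero.ne N)
    linarith
  have hw : ∀ i, ‖(ε * m.μ i) • m.v i‖ = ε * m.μ i := fun i => by
    rw [norm_smul, m.v.norm_eq_one, mul_one, Real.norm_of_nonneg]
    exact mul_nonneg hε.le (m.bounds hlam hLam i).1
  have hle : ∀ i, ‖(ε * m.μ i) • m.v i‖ ≤ ε * Real.sqrt Lam := fun i => by
    rw [hw]; exact mul_le_mul_of_nonneg_left (m.bounds hlam hLam i).2.2 hε.le
  have hsub : ∀ y : EuclideanSpace ℝ (Fin N), ‖y‖ ≤ R → 0 ≤ R ^ 2 - ‖y‖ ^ 2 := fun y hy =>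
    sub_nonneg.2 (pow_le_pow_left₀ (norm_nonneg y) hy 2)
  have h1 : ∀ i, 0 ≤ R ^ 2 - ‖x + (ε * m.μ i) • m.v i‖ ^ 2 := fun i =>
    hsub _ ((norm_add_le _ _).trans (add_le_add hx (hle i)))
  have h2 : ∀ i, 0 ≤ R ^ 2 - ‖x - (ε * m.μ i) • m.v i‖ ^ 2 := fun i =>
    hsub _ ((norm_sub_le _ _).trans (add_le_add hx (hle i)))
  have hc : (2 * (N : ℝ≥0∞))⁻¹ = ENNReal.ofReal ((2 * (N : ℝ))⁻¹) := by
    rw [ENNReal.ofReal_inv_of_pos hN, ENNReal.ofReal_mul (by norm_num), ENNReal.ofReal_natCast]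
    simp
  rw [Move.lintegral_law, hc]
  unfold potential
  simp only [← ENNReal.ofReal_add (h1 _) (h2 _)]
  rw [← ENNReal.ofReal_sum_of_nonneg fun i _ => add_nonneg (h1 i) (h2 i),
    ← ENNReal.ofReal_mul (by positivity), ← ENNReal.ofReal_add
      (mul_nonneg (by positivity) (Finset.sum_nonneg fun i _ => add_nonneg (h1 i) (h2 i)))
      (by positivity)]
  refine ENNReal.ofReal_le_ofReal ?_
  have hpar : ∀ i, R ^ 2 - ‖x + (ε * m.μ i) • m.v i‖ ^ 2 +
      (R ^ 2 - ‖x - (ε * m.μ i) • m.v i‖ ^ 2) ≤ 2 * (R ^ 2 - ‖x‖ ^ 2 - ε ^ 2 * lam) := fun i => by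
    have hp := parallelogram_law_with_norm ℝ x ((ε * m.μ i) • m.v i)
    rw [hw] at hp
    have hb := mul_le_mul_of_nonneg_left (m.bounds hlam hLam i).2.1 (sq_nonneg ε)
    nlinarith
  have hsum := Finset.sum_le_sum fun i (_ : i ∈ Finset.univ) => hpar i
  rw [Finset.sum_const, Finset.card_univ, Fintype.card_fin, nsmul_eq_mul] at hsum
  have := mul_le_mul_of_nonneg_left hsum (inv_nonneg.2 hN.le)
  have he : (2 * (N : ℝ))⁻¹ * (N * (2 * (R ^ 2 - ‖x‖ ^ 2 - ε ^ 2 * lam))) =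
      R ^ 2 - ‖x‖ ^ 2 - ε ^ 2 * lam := by
    have hN' : (N : ℝ) ≠ 0 := by exact_mod_cast NeZero.ne N
    field_simp
  linarith

/-- The number of times `n` with `xₙ ∈ Ω`. -/
noncomputable def occupation (Ω : Set (EuclideanSpace ℝ (Fin N))) (ω : Path N) : ℝ≥0∞ :=
  ∑' n, Ω.indicator 1 (ω n)

lemma Strategy.lintegral_potential_succ_add_le [NeZero N] (S : Strategy N lam Lam)
    (hΩ : IsOpen Ω) (hlam : 0 < lam) (hLam : lam < Lam) {ε r : ℝ} (hε : 0 < ε) (hr : ∀ x ∈ Ω, ‖x‖ ≤ r)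
    (x : EuclideanSpace ℝ (Fin N)) (n : ℕ) :
    ∫⁻ ω, potential (r + ε * Real.sqrt Lam) (ω (n + 1)) ∂(S.pathLaw hΩ ε x) +
        ENNReal.ofReal (ε ^ 2 * lam) * ∫⁻ ω, Ω.indicator 1 (ω n) ∂(S.pathLaw hΩ ε x) ≤
      ∫⁻ ω, potential (r + ε * Real.sqrt Lam) (ω n) ∂(S.pathLaw hΩ ε x) := by
  set R := r + ε * Real.sqrt Lam
  set P := S.pathLaw hΩ ε x with hP
  have hjoint : P.map (fun ω => ((Preorder.frestrictLe n ω : History N n), ω (n + 1))) =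
      (P.map (Preorder.frestrictLe n)) ⊗ₘ S.kernel hΩ ε n := by
    rw [hP, Strategy.pathLaw, Kernel.traj_map_frestrictLe_apply,
      Kernel.partialTraj_compProd_eq_map_traj (X := fun _ => EuclideanSpace ℝ (Fin N))
        (κ := fun n => S.kernel hΩ ε n) (b := n) (Nat.zero_le n)]
  have hφ := measurable_potential (N := N) R
  have hφ' : Measurable fun q : History N n × EuclideanSpace ℝ (Fin N) => potential R q.2 :=
    hφ.comp measurable_snd
  have hstep : ∫⁻ ω, potential R (ω (n + 1)) ∂P =
      ∫⁻ ω, ∫⁻ y, potential R y ∂(S.kernel hΩ ε n (Preorder.frestrictLe n ω)) ∂P := by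
    have h1 : ∫⁻ ω, potential R (ω (n + 1)) ∂P = ∫⁻ q, potential R q.2
        ∂(P.map (fun ω => ((Preorder.frestrictLe n ω : History N n), ω (n + 1)))) := by
      rw [lintegral_map hφ' (by fun_prop)]
    rw [h1, hjoint, Measure.lintegral_compProd hφ',
      lintegral_map (Measurable.lintegral_kernel hφ) (by fun_prop)]
  have hind : Measurable fun ω : Path N => (Ω.indicator 1 (ω n) : ℝ≥0∞) :=
    (measurable_one.indicator hΩ.measurableSet).comp (measurable_pi_apply n)
  rw [hstep, ← lintegral_const_mul _ hind, ← lintegral_add_right _ (hind.const_mul _)]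
  refine lintegral_mono fun ω => ?_
  change ∫⁻ y, potential R y ∂(S.stepLaw Ω ε _) + _ ≤ _
  have hl : History.last (n := n) (Preorder.frestrictLe n ω) = ω n := rfl
  by_cases h : ω n ∈ Ω
  · rw [Strategy.stepLaw, hl, if_pos h, Set.indicator_of_mem h, Pi.one_apply, mul_one]
    exact Move.lintegral_potential_add_le hlam hLam hε _ (hr _ h)
  · rw [Strategy.stepLaw, hl, if_neg h, Set.indicator_of_notMem h, mul_zero, add_zero,
      lintegral_dirac]

/-- The expected number of rounds is bounded uniformly in the strategy and the starting point. -/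
lemma exists_lintegral_occupation_le [NeZero N] (hΩ : IsOpen Ω)
    (hΩb : Bornology.IsBounded Ω) (hlam : 0 < lam) (hLam : lam < Lam) {ε : ℝ} (hε : 0 < ε) :
    ∃ K : ℝ≥0∞, K ≠ ∞ ∧ ∀ (S : Strategy N lam Lam) (x : EuclideanSpace ℝ (Fin N)),
      ∫⁻ ω, occupation Ω ω ∂(S.pathLaw hΩ ε x) ≤ K := by
  obtain ⟨r, hr⟩ := hΩb.exists_norm_le
  set R := r + ε * Real.sqrt Lam
  set c := ENNReal.ofReal (ε ^ 2 * lam)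
  have hc0 : c ≠ 0 := by
    have : 0 < ε ^ 2 * lam := by positivity
    simpa [c] using this
  have hct : c ≠ ∞ := ENNReal.ofReal_ne_top
  refine ⟨ENNReal.ofReal (R ^ 2) / c, ENNReal.div_ne_top ENNReal.ofReal_ne_top hc0, fun S x => ?_⟩
  have hind : ∀ n, Measurable fun ω : Path N => (Ω.indicator 1 (ω n) : ℝ≥0∞) := fun n =>
    (measurable_one.indicator hΩ.measurableSet).comp (measurable_pi_apply n)
  set P := S.pathLaw hΩ ε x
  have hpot : ∀ y : EuclideanSpace ℝ (Fin N), potential R y ≤ ENNReal.ofReal (R ^ 2) := fun y =>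
    ENNReal.ofReal_le_ofReal (sub_le_self _ (sq_nonneg _))
  have hsum : ∀ n, ∫⁻ ω, potential R (ω n) ∂P +
      c * ∑ k ∈ Finset.range n, ∫⁻ ω, Ω.indicator 1 (ω k) ∂P ≤ ENNReal.ofReal (R ^ 2) := by
    intro n
    induction n with
    | zero =>
      simp only [Finset.range_zero, Finset.sum_empty, mul_zero, add_zero]
      exact (lintegral_mono fun ω => hpot _).trans (by simp [P])
    | succ n ih =>
      rw [Finset.sum_range_succ, mul_add, add_comm (c * _), ← add_assoc]
      exact (add_le_add_left
        (S.lintegral_potential_succ_add_le hΩ hlam hLam hε hr x n) _).trans ih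
  unfold occupation
  rw [lintegral_tsum fun n => (hind n).aemeasurable]
  refine ENNReal.tsum_le_of_sum_range_le fun n => ?_
  rw [ENNReal.le_div_iff_mul_le (Or.inl hc0) (Or.inl hct), mul_comm]
  exact le_add_self.trans (hsum n)

/-! ### The payoff -/

lemma mem_of_lt_exitTime {ω : Path N} {k : ℕ} (hk : k < exitTime Ω ω) : ω k ∈ Ω := by
  by_contra h
  exact Nat.notMem_of_lt_sInf hk h

lemma exitTime_notMem {ω : Path N} (h : ∃ k, ω k ∉ Ω) : ω (exitTime Ω ω) ∉ Ω :=
  Nat.sInf_mem h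

/-- Equality can fail in general, as an arbitrary sequence may come back to `Ω`. -/
lemma exitTime_le_occupation (ω : Path N) : (exitTime Ω ω : ℝ≥0∞) ≤ occupation Ω ω := by
  refine le_trans ?_ (ENNReal.sum_le_tsum (Finset.range (exitTime Ω ω)))
  rw [Finset.sum_congr rfl fun k hk => Set.indicator_of_mem
    (mem_of_lt_exitTime (Finset.mem_range.1 hk)) _]
  simp

/-- Sequences that never leave `Ω` have the exit time `sInf ∅ = 0`, so they are not counted among
those with a large exit time. -/
lemma measurable_exitTime (hΩ : IsOpen Ω) : Measurable (exitTime Ω : Path N → ℕ) := by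
  have hm : ∀ k, MeasurableSet {ω : Path N | ω k ∉ Ω} := fun k =>
    (hΩ.measurableSet.preimage (measurable_pi_apply k)).compl
  refine measurable_of_Ioi fun n => ?_
  have : exitTime Ω ⁻¹' Set.Ioi n = {ω : Path N | ∃ k, ω k ∉ Ω} ∩
      {ω : Path N | ∀ k ≤ n, ω k ∈ Ω} := by
    ext ω
    simp only [Set.mem_preimage, Set.mem_Ioi, Set.mem_inter_iff, Set.mem_ofPred_eq]
    refine ⟨fun h => ⟨?_, fun k hk => mem_of_lt_exitTime (hk.trans_lt h)⟩, fun ⟨h1, h2⟩ => ?_⟩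
    · by_contra hne
      push Not at hne
      have : {k | ω k ∉ Ω} = ∅ := by ext k; simp [hne k]
      simp [exitTime, this] at h
    · by_contra hle
      exact exitTime_notMem h1 (h2 _ (not_lt.1 hle))
  rw [this]
  refine MeasurableSet.inter ?_ ?_
  · rw [Set.ofPred_exists]; exact MeasurableSet.iUnion hm
  · simp only [Set.ofPred_forall]
    exact MeasurableSet.iInter fun k => MeasurableSet.iInter fun _ =>
      (measurable_pi_apply k) hΩ.measurableSet

/-- Only the values of `f` in `Ω` and of `g` outside `Ω` enter the payoff of a sequence that
leaves `Ω`. -/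
lemma payoff_eq_indicator (ε : ℝ) (f g : EuclideanSpace ℝ (Fin N) → ℝ) {ω : Path N}
    (h : ∃ k, ω k ∉ Ω) :
    payoff Ω ε f g ω = payoff Ω ε (Ω.indicator f) (Ωᶜ.indicator g) ω := by
  unfold payoff
  rw [Set.indicator_of_mem (s := Ωᶜ) (exitTime_notMem h)]
  congr 2
  exact Finset.sum_congr rfl fun k hk =>
    (Set.indicator_of_mem (mem_of_lt_exitTime (Finset.mem_range.1 hk)) f).symm

lemma measurable_payoff (hΩ : IsOpen Ω) (ε : ℝ) {f g : EuclideanSpace ℝ (Fin N) → ℝ}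
    (hf : Measurable f) (hg : Measurable g) : Measurable (payoff Ω ε f g) := by
  have h : ∀ n : ℕ, Measurable fun ω : Path N =>
      g (ω n) - 1 / (2 * (N : ℝ)) * ε ^ 2 * ∑ k ∈ Finset.range n, f (ω k) := fun n =>
    (hg.comp (measurable_pi_apply n)).sub
      ((Finset.measurable_fun_sum _ fun k _ => hf.comp (measurable_pi_apply k)).const_mul _)
  exact measurable_select h (measurable_exitTime hΩ) (Set.to_countable _)

lemma measurable_indicator_of_continuousOn {E : Type*} [TopologicalSpace E] [MeasurableSpace E]
    [BorelSpace E] {s : Set E} (hs : MeasurableSet s) {f : E → ℝ} (hf : ContinuousOn f s) :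
    Measurable (s.indicator f) := by
  classical
  rw [← Set.piecewise_eq_indicator]
  exact hf.measurable_piecewise continuousOn_const hs

/-- The absolute value `|C|` covers an empty `Ω`, where the bound `C` may be negative. -/
lemma abs_payoff_le {f g : EuclideanSpace ℝ (Fin N) → ℝ} {C G : ℝ} (hC : ∀ x ∈ Ω, |f x| ≤ C)
    (hG : ∀ x ∈ Ωᶜ, |g x| ≤ G) (ε : ℝ) {ω : Path N} (h : ∃ k, ω k ∉ Ω) :
    |payoff Ω ε f g ω| ≤ G + 1 / (2 * (N : ℝ)) * ε ^ 2 * |C| * exitTime Ω ω := by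
  unfold payoff
  refine (abs_sub _ _).trans (add_le_add (hG _ (exitTime_notMem h)) ?_)
  rw [abs_mul, abs_of_nonneg (by positivity : 0 ≤ 1 / (2 * (N : ℝ)) * ε ^ 2), mul_assoc _ |C|]
  refine mul_le_mul_of_nonneg_left ?_ (by positivity)
  refine (Finset.abs_sum_le_sum_abs _ _).trans ((Finset.sum_le_sum fun k hk =>
    (hC _ (mem_of_lt_exitTime (Finset.mem_range.1 hk))).trans (le_abs_self C)).trans ?_)
  simp [mul_comm]

/-- The sum over the rounds splits off the first one. -/
lemma payoff_shift {ω : Path N} (h0 : ω 0 ∈ Ω) (h : ∃ k, ω k ∉ Ω) (ε : ℝ)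
    (f g : EuclideanSpace ℝ (Fin N) → ℝ) :
    payoff Ω ε f g ω = -(1 / (2 * (N : ℝ))) * ε ^ 2 * f (ω 0) + payoff Ω ε f g ω.shift := by
  have ht : exitTime Ω ω = exitTime Ω ω.shift + 1 := by
    unfold exitTime
    have h1 : 1 ≤ sInf {k | ω k ∉ Ω} := by
      rw [Nat.one_le_iff_ne_zero]
      intro h0'
      have hmem : sInf {k | ω k ∉ Ω} ∈ {k | ω k ∉ Ω} := Nat.sInf_mem h
      rw [h0'] at hmem
      exact hmem h0
    exact (Nat.sInf_add (p := fun k => ω k ∉ Ω) h1).symm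
  unfold payoff
  rw [ht, Finset.sum_range_succ']
  simp only [Path.shift]
  ring

lemma Strategy.ae_exists_notMem [NeZero N] (S : Strategy N lam Lam) (hΩ : IsOpen Ω)
    (hΩb : Bornology.IsBounded Ω) (hlam : 0 < lam) (hLam : lam < Lam) {ε : ℝ} (hε : 0 < ε)
    (x : EuclideanSpace ℝ (Fin N)) : ∀ᵐ ω ∂(S.pathLaw hΩ ε x), ∃ k, ω k ∉ Ω := by
  obtain ⟨K, hK, h⟩ := exists_lintegral_occupation_le (N := N) hΩ hΩb hlam hLam hε
  have hm : Measurable (occupation Ω : Path N → ℝ≥0∞) := Measurable.tsum fun n =>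
    (measurable_one.indicator hΩ.measurableSet).comp (measurable_pi_apply n)
  filter_upwards [ae_lt_top hm ((h S x).trans_lt hK.lt_top).ne] with ω hω
  by_contra hne
  push Not at hne
  refine hω.ne ?_
  simp [occupation, Set.indicator_of_mem (hne _)]

/-- Payoffs are integrable, with `L¹` norms bounded uniformly in the strategy and the starting
point. -/
lemma exists_lintegral_payoff_le [NeZero N] (hΩ : IsOpen Ω) (hΩb : Bornology.IsBounded Ω)
    (hlam : 0 < lam) (hLam : lam < Lam) {ε : ℝ} (hε : 0 < ε)
    {f g : EuclideanSpace ℝ (Fin N) → ℝ} (hf : ContinuousOn f Ω)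
    (hfb : ∃ C, ∀ x ∈ Ω, |f x| ≤ C) (hg : ContinuousOn g Ωᶜ) (hgb : ∃ C, ∀ x ∈ Ωᶜ, |g x| ≤ C) :
    ∃ B : ℝ, ∀ (S : Strategy N lam Lam) (x : EuclideanSpace ℝ (Fin N)),
      Integrable (payoff Ω ε f g) (S.pathLaw hΩ ε x) ∧ |S.expectedPayoff hΩ ε f g x| ≤ B := by
  obtain ⟨C, hC⟩ := hfb
  obtain ⟨G, hG⟩ := hgb
  obtain ⟨K, hK, h⟩ := exists_lintegral_occupation_le (N := N) hΩ hΩb hlam hLam hε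
  set b := 1 / (2 * (N : ℝ)) * ε ^ 2 * |C| with hb
  have hb0 : 0 ≤ b := by positivity
  set B := ENNReal.ofReal G + ENNReal.ofReal b * K
  have hB : B ≠ ∞ :=
    ENNReal.add_ne_top.2 ⟨ENNReal.ofReal_ne_top, ENNReal.mul_ne_top ENNReal.ofReal_ne_top hK⟩
  have hm : Measurable (occupation Ω : Path N → ℝ≥0∞) := Measurable.tsum fun n =>
    (measurable_one.indicator hΩ.measurableSet).comp (measurable_pi_apply n)
  refine ⟨B.toReal, fun S x => ?_⟩
  have hae := S.ae_exists_notMem hΩ hΩb hlam hLam hε x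
  have hle : ∫⁻ ω, ‖payoff Ω ε f g ω‖ₑ ∂(S.pathLaw hΩ ε x) ≤ B := by
    calc ∫⁻ ω, ‖payoff Ω ε f g ω‖ₑ ∂(S.pathLaw hΩ ε x)
        ≤ ∫⁻ ω, (ENNReal.ofReal G + ENNReal.ofReal b * occupation Ω ω)
            ∂(S.pathLaw hΩ ε x) := by
          refine lintegral_mono_ae ?_
          filter_upwards [hae] with ω hω
          rw [Real.enorm_eq_ofReal_abs]
          refine (ENNReal.ofReal_le_ofReal (abs_payoff_le hC hG ε hω)).trans
            (ENNReal.ofReal_add_le.trans ?_)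
          rw [← hb, ENNReal.ofReal_mul hb0, ENNReal.ofReal_natCast]
          gcongr
          exact exitTime_le_occupation ω
      _ ≤ B := by
          rw [lintegral_add_left measurable_const, lintegral_const_mul _ hm,
            lintegral_const, measure_univ, mul_one]
          change _ ≤ ENNReal.ofReal G + ENNReal.ofReal b * K
          gcongr
          exact h S x
  have hmeas : AEStronglyMeasurable (payoff Ω ε f g) (S.pathLaw hΩ ε x) := by
    refine ⟨_, (measurable_payoff hΩ ε
      (measurable_indicator_of_continuousOn hΩ.measurableSet hf)
      (measurable_indicator_of_continuousOn hΩ.measurableSet.compl hg)).stronglyMeasurable, ?_⟩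
    filter_upwards [hae] with ω hω
    exact payoff_eq_indicator ε f g hω
  refine ⟨⟨hmeas, hle.trans_lt hB.lt_top⟩, ?_⟩
  have h1 := (enorm_integral_le_lintegral_enorm (μ := S.pathLaw hΩ ε x) (payoff Ω ε f g)).trans hle
  have h2 := ENNReal.toReal_mono hB h1
  rwa [toReal_enorm] at h2

/-! ### The dynamic programming principle -/

/-- Conditioning on the first step: the expected payoff in terms of strategies `T y` that continue
the given strategy from the `2N` possible positions `y` after that step. -/
lemma Strategy.expectedPayoff_eq_total [NeZero N] (hΩ : IsOpen Ω) {ε : ℝ}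
    {f g : EuclideanSpace ℝ (Fin N) → ℝ}
    (hend : ∀ (S : Strategy N lam Lam) (x : EuclideanSpace ℝ (Fin N)),
      ∀ᵐ ω ∂(S.pathLaw hΩ ε x), ∃ k, ω k ∉ Ω)
    (hint : ∀ (S : Strategy N lam Lam) (x : EuclideanSpace ℝ (Fin N)),
      Integrable (payoff Ω ε f g) (S.pathLaw hΩ ε x))
    (S : Strategy N lam Lam) (T : EuclideanSpace ℝ (Fin N) → Strategy N lam Lam)
    {x : EuclideanSpace ℝ (Fin N)} (hx : x ∈ Ω) {m : Move N lam Lam}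
    (hm : S.act 0 (fun _ => x) = m)
    (hadd : ∀ i, S.Continues (T (x + (ε * m.μ i) • m.v i)) x (x + (ε * m.μ i) • m.v i))
    (hsub : ∀ i, S.Continues (T (x - (ε * m.μ i) • m.v i)) x (x - (ε * m.μ i) • m.v i)) :
    S.expectedPayoff hΩ ε f g x = -(1 / (2 * (N : ℝ))) * ε ^ 2 * f x +
      1 / (2 * (N : ℝ)) * m.total ε (fun y => (T y).expectedPayoff hΩ ε f g y) x := by
  have hN : (N : ℝ) ≠ 0 := by exact_mod_cast NeZero.ne N
  -- One summand: the conditional expectation given the position `y` after the first step.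
  have hfrom : ∀ y, S.Continues (T y) x y →
      Integrable (payoff Ω ε f g) (S.pathLawFrom hΩ ε x y) ∧
      ∫ ω, payoff Ω ε f g ω ∂(S.pathLawFrom hΩ ε x y) =
        -(1 / (2 * (N : ℝ))) * ε ^ 2 * f x + (T y).expectedPayoff hΩ ε f g y := by
    intro y hy
    have hmap := Strategy.map_shift_pathLawFrom hy hΩ ε
    have hend' := hend (T y) y
    have hint' := hint (T y) y
    rw [← hmap] at hend' hint'
    have hi : Integrable (fun ω : Path N => payoff Ω ε f g ω.shift) (S.pathLawFrom hΩ ε x y) :=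
      hint'.comp_measurable Path.measurable_shift
    have hae : payoff Ω ε f g =ᵐ[S.pathLawFrom hΩ ε x y] fun ω =>
        -(1 / (2 * (N : ℝ))) * ε ^ 2 * f x + payoff Ω ε f g ω.shift := by
      filter_upwards [S.ae_pathLawFrom hΩ ε x y,
        ae_of_ae_map Path.measurable_shift.aemeasurable hend'] with ω hω hk
      obtain ⟨k, hk⟩ := hk
      rw [payoff_shift (hω.1 ▸ hx) ⟨k + 1, hk⟩, hω.1]
    refine ⟨((integrable_const _).add hi).congr hae.symm, ?_⟩
    rw [integral_congr_ae hae, integral_add (integrable_const _) hi, integral_const,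
      Strategy.expectedPayoff, ← hmap,
      integral_map Path.measurable_shift.aemeasurable hint'.aestronglyMeasurable]
    simp
  have hsum := S.pathLaw_eq_average hΩ ε hx
  simp only [hm] at hsum
  rw [Strategy.expectedPayoff, hsum, integral_smul_measure,
    integral_finsetSum_measure fun i _ =>
      (hfrom _ (hadd i)).1.add_measure (hfrom _ (hsub i)).1]
  simp only [integral_add_measure (hfrom _ (hadd _)).1 (hfrom _ (hsub _)).1,
    (hfrom _ (hadd _)).2, (hfrom _ (hsub _)).2]
  have hc : ((2 * (N : ℝ≥0∞))⁻¹).toReal = 1 / (2 * (N : ℝ)) := by simp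
  rw [hc, smul_eq_mul, Move.total]
  simp only [Finset.sum_add_distrib, Finset.sum_const, Finset.card_univ, Fintype.card_fin,
    nsmul_eq_mul]
  field_simp
  ring

/-- The constant move along the standard basis. -/
noncomputable instance : Inhabited (Move N lam Lam) :=
  ⟨⟨EuclideanSpace.basisFun (Fin N) ℝ, fun _ => Real.sqrt lam, fun _ => Or.inl rfl⟩⟩

noncomputable instance : Inhabited (Strategy N lam Lam) :=
  ⟨⟨fun _ _ => default, fun _ => measurable_const, fun _ => measurable_const⟩⟩

lemma Move.total_mono (m : Move N lam Lam) (ε : ℝ) {u w : EuclideanSpace ℝ (Fin N) → ℝ}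
    (h : ∀ y, u y ≤ w y) (x : EuclideanSpace ℝ (Fin N)) : m.total ε u x ≤ m.total ε w x :=
  Finset.sum_le_sum fun _ _ => add_le_add (h _) (h _)

lemma Move.total_const (m : Move N lam Lam) (ε c : ℝ) (x : EuclideanSpace ℝ (Fin N)) :
    m.total ε (fun _ => c) x = 2 * N * c := by
  simp [Move.total]
  ring

lemma Move.total_sub_const (m : Move N lam Lam) (ε c : ℝ) (u : EuclideanSpace ℝ (Fin N) → ℝ)
    (x : EuclideanSpace ℝ (Fin N)) :
    m.total ε (fun y => u y - c) x = m.total ε u x - 2 * N * c := by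
  rw [← m.total_const ε c x]
  simp only [Move.total, ← Finset.sum_sub_distrib]
  exact Finset.sum_congr rfl fun _ _ => by ring

/-- From `x`, the player can play `m` and then `σ y` from each of the `2N` possible positions `y`.
-/
lemma exists_strategy_of_move [NeZero N] (hΩ : IsOpen Ω) {ε : ℝ}
    {f g : EuclideanSpace ℝ (Fin N) → ℝ}
    (hend : ∀ (S : Strategy N lam Lam) (x : EuclideanSpace ℝ (Fin N)),
      ∀ᵐ ω ∂(S.pathLaw hΩ ε x), ∃ k, ω k ∉ Ω)
    (hint : ∀ (S : Strategy N lam Lam) (x : EuclideanSpace ℝ (Fin N)),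
      Integrable (payoff Ω ε f g) (S.pathLaw hΩ ε x))
    (m : Move N lam Lam) (σ : EuclideanSpace ℝ (Fin N) → Strategy N lam Lam)
    {x : EuclideanSpace ℝ (Fin N)} (hx : x ∈ Ω) :
    ∃ S : Strategy N lam Lam,
      S.expectedPayoff hΩ ε f g x = -(1 / (2 * (N : ℝ))) * ε ^ 2 * f x +
        1 / (2 * (N : ℝ)) * m.total ε (fun y => (σ y).expectedPayoff hΩ ε f g y) x := by
  classical
  let P : Set (EuclideanSpace ℝ (Fin N)) :=
    Set.range (fun i => x + (ε * m.μ i) • m.v i) ∪ Set.range fun i => x - (ε * m.μ i) • m.v i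
  have hP : P.Finite := (Set.finite_range _).union (Set.finite_range _)
  -- The identity on the reachable positions, with a finite range.
  let k : EuclideanSpace ℝ (Fin N) → EuclideanSpace ℝ (Fin N) := P.piecewise id fun _ => x
  have hk : Measurable k := measurable_id.piecewise hP.measurableSet measurable_const
  have hkc : (Set.range k).Countable := by
    refine ((hP.insert x).subset ?_).countable
    rintro _ ⟨y, rfl⟩
    by_cases hy : y ∈ P
    · exact Or.inr ((congrArg (· ∈ P) (Set.piecewise_eq_of_mem P id _ hy)).mpr hy)
    · exact Or.inl (Set.piecewise_eq_of_notMem P id _ hy)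
  refine ⟨Strategy.prepend m σ k hk hkc,
    Strategy.expectedPayoff_eq_total hΩ hend hint _ σ hx rfl (fun i => ?_) fun i => ?_⟩
  · exact Strategy.continues_prepend m σ k hk hkc x _
      (Set.piecewise_eq_of_mem _ _ _ (Or.inl ⟨i, rfl⟩))
  · exact Strategy.continues_prepend m σ k hk hkc x _
      (Set.piecewise_eq_of_mem _ _ _ (Or.inr ⟨i, rfl⟩))

lemma Strategy.expectedPayoff_of_notMem [NeZero N] (S : Strategy N lam Lam) (hΩ : IsOpen Ω)
    (ε : ℝ) (f g : EuclideanSpace ℝ (Fin N) → ℝ) {x : EuclideanSpace ℝ (Fin N)} (hx : x ∉ Ω) :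
    S.expectedPayoff hΩ ε f g x = g x := by
  have : payoff Ω ε f g =ᵐ[S.pathLaw hΩ ε x] fun _ => g x := by
    filter_upwards [S.ae_pathLaw_zero hΩ ε x] with ω hω
    have ht : exitTime Ω ω = 0 := Nat.sInf_eq_zero.2 (Or.inl (by simpa [hω] using hx))
    simp [payoff, ht, hω]
  rw [Strategy.expectedPayoff, integral_congr_ae this]
  simp

end PucciGame

theorem theorem1p1 {N : ℕ} [NeZero N] {Ω : Set (EuclideanSpace ℝ (Fin N))} (hΩ : IsOpen Ω)
    (hΩb : Bornology.IsBounded Ω) {lam Lam ε : ℝ} (hlam : 0 < lam) (hLam : lam < Lam) (hε : 0 < ε)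
    (f g : EuclideanSpace ℝ (Fin N) → ℝ)
    (hf : UniformContinuousOn f Ω) (hfb : ∃ C, ∀ x ∈ Ω, |f x| ≤ C)
    (hg : ContinuousOn g Ωᶜ) (hgb : ∃ C, ∀ x ∈ Ωᶜ, |g x| ≤ C) :
    -- the game ends almost surely and the expected payoffs are well defined
    (∀ (S : PucciGame.Strategy N lam Lam) (x : EuclideanSpace ℝ (Fin N)),
      (∀ᵐ ω ∂(S.pathLaw hΩ ε x), ∃ k, ω k ∉ Ω) ∧
      Integrable (PucciGame.payoff Ω ε f g) (S.pathLaw hΩ ε x)) ∧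
    -- the suprema below are finite
    (∀ x, BddAbove (Set.range fun S : PucciGame.Strategy N lam Lam =>
      S.expectedPayoff hΩ ε f g x)) ∧
    (∀ x ∈ Ω, BddAbove (Set.range fun m : PucciGame.Move N lam Lam =>
      m.total ε (PucciGame.value hΩ lam Lam ε f g) x)) ∧
    -- the dynamic programming principle
    (∀ x ∈ Ω, PucciGame.value hΩ lam Lam ε f g x =
      -(1 / (2 * (N : ℝ))) * ε ^ 2 * f x +
        1 / (2 * (N : ℝ)) * ⨆ m : PucciGame.Move N lam Lam,
          m.total ε (PucciGame.value hΩ lam Lam ε f g) x) ∧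
    (∀ x ∉ Ω, PucciGame.value hΩ lam Lam ε f g x = g x) := by
  open PucciGame in
  obtain ⟨B, hB⟩ := exists_lintegral_payoff_le (lam := lam) (Lam := Lam) hΩ hΩb hlam hLam hε
    hf.continuousOn hfb hg hgb
  have hend : ∀ (S : Strategy N lam Lam) (x : EuclideanSpace ℝ (Fin N)),
      ∀ᵐ ω ∂(S.pathLaw hΩ ε x), ∃ k, ω k ∉ Ω :=
    fun S => S.ae_exists_notMem hΩ hΩb hlam hLam hε
  have hint : ∀ (S : Strategy N lam Lam) (x : EuclideanSpace ℝ (Fin N)),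
      Integrable (payoff Ω ε f g) (S.pathLaw hΩ ε x) := fun S x => (hB S x).1
  have hbdd : ∀ x, BddAbove (Set.range fun S : Strategy N lam Lam =>
      S.expectedPayoff hΩ ε f g x) := fun x =>
    ⟨B, by rintro _ ⟨S, rfl⟩; exact (abs_le.1 (hB S x).2).2⟩
  set u := value hΩ lam Lam ε f g with hu
  have hle : ∀ (S : Strategy N lam Lam) x, S.expectedPayoff hΩ ε f g x ≤ u x := fun S x =>
    le_ciSup (hbdd x) S
  have huB : ∀ x, u x ≤ B := fun x => ciSup_le fun S => (abs_le.1 (hB S x).2).2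
  have hbddm : ∀ x, BddAbove (Set.range fun m : Move N lam Lam => m.total ε u x) := fun x =>
    ⟨2 * N * B, by
      rintro _ ⟨m, rfl⟩
      exact (m.total_mono ε huB x).trans_eq (m.total_const ε B x)⟩
  have hN : (0 : ℝ) < N := by exact_mod_cast Nat.pos_of_ne_zero (NeZero.ne N)
  refine ⟨fun S x => ⟨hend S x, hint S x⟩, hbdd, fun x _ => hbddm x, fun x hx => ?_, fun x hx => ?_⟩
  · refine le_antisymm (ciSup_le fun S => ?_) ?_
    · rw [S.expectedPayoff_eq_total hΩ hend hint (fun _ => S.after x) hx rfl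
        (fun i => S.continues_after x _) fun i => S.continues_after x _]
      gcongr
      exact (Move.total_mono _ ε (fun y => hle _ y) x).trans (le_ciSup (hbddm x) _)
    · rw [← le_sub_iff_add_le', ← le_div_iff₀' (by positivity)]
      refine ciSup_le fun m => ?_
      rw [le_div_iff₀' (by positivity), le_sub_iff_add_le']
      refine le_of_forall_pos_sub_le fun δ hδ => ?_
      -- After the move `m`, play `δ`-optimally.
      have hσ : ∀ y, ∃ S : Strategy N lam Lam, u y - δ < S.expectedPayoff hΩ ε f g y := fun y =>
        exists_lt_of_lt_ciSup (sub_lt_self (u y) hδ)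
      choose σ hσ using hσ
      obtain ⟨S, hS⟩ := exists_strategy_of_move hΩ hend hint m σ hx
      have h1 := m.total_mono ε (fun y => (hσ y).le) x
      rw [m.total_sub_const] at h1
      have h2 := mul_le_mul_of_nonneg_left h1 (by positivity : 0 ≤ 1 / (2 * (N : ℝ)))
      have h3 : 1 / (2 * (N : ℝ)) * (m.total ε u x - 2 * N * δ) =
          1 / (2 * (N : ℝ)) * m.total ε u x - δ := by
        field_simp
      have h4 := hle S x
      linarith
  · exact (congrArg iSup (funext fun S => S.expectedPayoff_of_notMem hΩ ε f g hx)).trans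
      ciSup_const
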